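/- Let $K$ be a scattered compact Hausdorff space (scattered: every nonempty subset of $K$ has a relatively isolated point), and let $C(K)$ be the Banach space of continuous real-valued functions on $K$ with the supremum norm. A Banach space $X$ is called weakly pcc if every point-finite family of weakly open subsets of $X$ is countable (point-finite: each point of $X$ belongs to only finitely many members of the family). Given $m\in\mathbb{N}$ and a partition $F_1,\ldots,F_k$ of $\{1,\ldots,m\}$ into nonempty sets, a point $(x_1,\ldots,x_m)\in K^m$ is called $(F_1,\ldots,F_k)$-diverse if $\{x_j : j\in F_i\}\cap\{x_j : j\notin F_i\}=\emptyset$ for all $1\le i\le k$. For $n\in\mathbb{N}$, the space $K$ is called $n$-diverse if for every $m\in\mathbb{N}$ and every partition $F_1,\ldots,F_k$ of $\{1,\ldots,m\}$ with $k\le n$, every sequence $((x_1^\alpha,\ldots,x_m^\alpha))_{\alpha<\omega_1}$ of $(F_1,\ldots,F_k)$-diverse points of $K^m$ has a cluster point in $K^m$ which is $(F_1,\ldots,F_k)$-diverse; here $x\in K^m$ is a cluster point of $(x^\alpha)_{\alpha<\omega_1}$ if every neighbourhood of $x$ contains $x^\alpha$ for infinitely many $\alpha<\omega_1$. Then $C(K)$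 is weakly pcc if and only if $K$ is $n$-diverse for every $n\in\mathbb{N}$. -/

import Mathlib

open Set Filter Topology
open scoped Ordinal

/-- A space is scattered if every nonempty subset has a point isolated in that subset. -/
def IsScattered (K : Type*) [TopologicalSpace K] : Prop :=
  ∀ S : Set K, S.Nonempty → ∃ x ∈ S, ∃ U : Set K, IsOpen U ∧ U ∩ S = {x}

/-- A real normed space is weakly pcc if every point-finite family of weakly open sets is
countable. A family is a set of sets, so no member is repeated. -/
def IsWeaklyPcc (X : Type*) [NormedAddCommGroup X] [NormedSpace ℝ X] : Prop :=
  ∀ 𝒰 : Set (Set (WeakSpace ℝ X)),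
    (∀ U ∈ 𝒰, IsOpen U) → (∀ x : WeakSpace ℝ X, {U ∈ 𝒰 | x ∈ U}.Finite) → 𝒰.Countable

/-- `F 0, …, F (k - 1)` is a partition of `{0, …, m - 1}` into `k` nonempty pieces. -/
structure IsPartitionInto {m k : ℕ} (F : Fin k → Set (Fin m)) : Prop where
  nonempty : ∀ i, (F i).Nonempty
  disjoint : ∀ i j, i ≠ j → Disjoint (F i) (F j)
  cover : ⋃ i, F i = univ

/-- `x ∈ K ^ m` is `F`-diverse if for each `i` no value of `x` at an index in `F i` equals a value
at an index outside `F i`. -/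
def IsDiversePoint {K : Type*} {m k : ℕ} (F : Fin k → Set (Fin m)) (x : Fin m → K) : Prop :=
  ∀ i, x '' F i ∩ x '' (F i)ᶜ = ∅

/-- `K` is `n`-diverse: for every `m` and every partition `F` of an `m`-element set into at most
`n` pieces, each `ω₁`-sequence of `F`-diverse points of `K ^ m` has an `F`-diverse cluster point
in `K ^ m`. Being a cluster point with respect to `cofinite` means that every neighbourhood of
the point contains the `α`-th term for infinitely many indices `α < ω₁`. -/
def IsNDiverse (K : Type*) [TopologicalSpace K] (n : ℕ) : Prop :=
  ∀ (m k : ℕ) (F : Fin k → Set (Fin m)), k ≤ n → IsPartitionInto F →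
    ∀ u : Iio (ω₁ : Ordinal.{0}) → (Fin m → K), (∀ α, IsDiversePoint F (u α)) →
      ∃ x : Fin m → K, IsDiversePoint F x ∧ MapClusterPt x cofinite u

/-! On a scattered compact space every functional is nearly carried by finitely many points, so on
norm-bounded sets the weak topology is that of pointwise convergence
(`IsScattered.exists_finset_forall_mem_of_isOpen`). Hence a nonempty weakly open set contains a box
given by a norm bound, finitely many points and rational values there
(`IsScattered.exists_weak_box`). Apart from the points the data are countable, so an uncountable
family has ω₁ members sharing them. Their point tuples are diverse for the partition by value; a
function interpolating the values at a diverse cluster point lies in infinitely many members.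
Conversely, given diverse tuples, consider the functions that nearly equal the label of each piece
at the points of one tuple. A function in infinitely many of these sets separates the pieces at some
cluster point, by compactness, so that point is diverse. This half does not need scatteredness. -/

/-! ### Functionals on `C(K)` and the weak topology on bounded sets -/

section FunctionalsOnScatteredSpaces

variable {K : Type*} [TopologicalSpace K]

/-- The function `h` pushed towards zero by `δ`: it vanishes where `|h| ≤ δ`. -/
def softThreshold (δ : ℝ) (h : C(K, ℝ)) : C(K, ℝ) where
  toFun x := h x - max (-δ) (min δ (h x))

theorem softThreshold_apply (δ : ℝ) (h : C(K, ℝ)) (x : K) :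
    softThreshold δ h x = h x - max (-δ) (min δ (h x)) := rfl

theorem softThreshold_eq_zero {δ : ℝ} {h : C(K, ℝ)} {x : K} (hx : |h x| ≤ δ) :
    softThreshold δ h x = 0 := by
  rw [abs_le] at hx
  rw [softThreshold_apply, min_eq_right hx.2, max_eq_right hx.1, sub_self]

theorem abs_softThreshold_le {δ : ℝ} (hδ : 0 ≤ δ) (h : C(K, ℝ)) (x : K) :
    |softThreshold δ h x| ≤ |h x| := by
  rw [softThreshold_apply]
  rcases max_cases (-δ) (min δ (h x)) with ⟨h₁, _⟩ | ⟨h₁, _⟩ <;>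
  rcases min_cases δ (h x) with ⟨h₂, _⟩ | ⟨h₂, _⟩ <;>
  rcases abs_cases (h x) with ⟨h₃, _⟩ | ⟨h₃, _⟩ <;>
  rw [h₁, h₃, abs_le] <;> constructor <;> linarith

variable [CompactSpace K]

theorem norm_softThreshold_le {δ : ℝ} (hδ : 0 ≤ δ) (h : C(K, ℝ)) :
    ‖softThreshold δ h‖ ≤ ‖h‖ :=
  (ContinuousMap.norm_le _ (norm_nonneg _)).2 fun x ↦
    (abs_softThreshold_le hδ h x).trans (h.norm_coe_le_norm x)

theorem norm_sub_softThreshold_le {δ : ℝ} (hδ : 0 ≤ δ) (h : C(K, ℝ)) :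
    ‖h - softThreshold δ h‖ ≤ δ := by
  refine (ContinuousMap.norm_le _ hδ).2 fun x ↦ ?_
  rw [ContinuousMap.sub_apply, softThreshold_apply, sub_sub_cancel, Real.norm_eq_abs, abs_le]
  exact ⟨le_max_left _ _, max_le (by linarith) (min_le_left _ _)⟩

/-- The restriction of the functional `φ` to functions supported in `U` is carried, up to
arbitrarily small error, by finite sets of points. -/
def IsFinitelyConcentrated (φ : C(K, ℝ) →L[ℝ] ℝ) (U : Set K) : Prop :=
  ∀ ε > 0, ∃ S : Finset K, ∀ h : C(K, ℝ), ‖h‖ ≤ 1 → (∀ x ∉ U, h x = 0) → (∀ x ∈ S, h x = 0) →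
    |φ h| ≤ ε

/-- Almost all of the mass of `φ` on `U` lies on a compact subset of `U`. -/
theorem exists_isCompact_abs_apply_le (φ : C(K, ℝ) →L[ℝ] ℝ) (U : Set K) {ε : ℝ} (hε : 0 < ε) :
    ∃ C ⊆ U, IsCompact C ∧ ∀ h : C(K, ℝ), ‖h‖ ≤ 1 → (∀ x ∉ U, h x = 0) → (∀ x ∈ C, h x = 0) →
      |φ h| ≤ ε := by
  set A : Set ℝ := φ '' {h | ‖h‖ ≤ 1 ∧ ∀ x ∉ U, h x = 0} with hA
  have hne : A.Nonempty := ⟨φ 0, 0, by simp, rfl⟩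
  have hbdd : BddAbove A := by
    refine ⟨‖φ‖, ?_⟩
    rintro _ ⟨h, ⟨hh, -⟩, rfl⟩
    exact (le_abs_self _).trans (φ.le_of_opNorm_le_of_le le_rfl hh |>.trans (by simp))
  -- A near-maximiser `f` of `φ` decides the compact set `{δ ≤ |f|}`. Its truncation `g` vanishes
  -- off that set and `h` on it, so `g + h` still competes for the supremum and `φ h` is at most the
  -- defect of `g`.
  obtain ⟨_, ⟨f, ⟨hf, hfU⟩, rfl⟩, hfs⟩ :=
    exists_lt_of_lt_csSup hne (sub_lt_self (sSup A) (half_pos hε))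
  obtain ⟨δ, hδ, hδε⟩ : ∃ δ > 0, ‖φ‖ * δ ≤ ε / 2 := by
    refine ⟨ε / 2 / (‖φ‖ + 1), by positivity, ?_⟩
    rw [mul_div_assoc', div_le_iff₀ (by positivity)]
    nlinarith [norm_nonneg φ]
  set g := softThreshold δ f with hg
  have hgf : φ f - φ g ≤ ε / 2 := by
    rw [← map_sub]
    exact (le_abs_self _).trans ((φ.le_of_opNorm_le_of_le le_rfl
      (norm_sub_softThreshold_le hδ.le f)).trans hδε)
  refine ⟨{x | δ ≤ |f x|}, fun x hx ↦ ?_, ?_, ?_⟩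
  · by_contra hxU
    rw [mem_ofPred_eq, hfU x hxU, abs_zero] at hx
    linarith
  · exact (isClosed_le continuous_const (by fun_prop)).isCompact
  · have key : ∀ h : C(K, ℝ), ‖h‖ ≤ 1 → (∀ x ∉ U, h x = 0) →
        (∀ x ∈ {x | δ ≤ |f x|}, h x = 0) → φ h ≤ ε := by
      intro h hh hhU hhC
      have hmem : φ (g + h) ∈ A := by
        refine ⟨g + h, ⟨(ContinuousMap.norm_le _ zero_le_one).2 fun x ↦ ?_, fun x hx ↦ ?_⟩, rfl⟩
        · rw [ContinuousMap.add_apply]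
          by_cases hx : δ ≤ |f x|
          · rw [hhC x hx, add_zero]
            exact (g.norm_coe_le_norm x).trans ((norm_softThreshold_le hδ.le f).trans hf)
          · rw [hg, softThreshold_eq_zero (not_le.1 hx).le, zero_add]
            exact (h.norm_coe_le_norm x).trans hh
        · rw [ContinuousMap.add_apply, hhU x hx, hg,
            softThreshold_eq_zero (by rw [hfU x hx, abs_zero]; exact hδ.le), add_zero]
      have := le_csSup hbdd hmem
      rw [map_add] at this
      linarith
    intro h hh hhU hhC
    refine abs_le.2 ⟨?_, key h hh hhU hhC⟩
    have := key (-h) (by rwa [norm_neg]) (fun x hx ↦ by simp [hhU x hx])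
      (fun x hx ↦ by simp [hhC x hx])
    rw [map_neg] at this
    linarith

variable [T2Space K]

/-- A compact set carrying most of the mass meets only finitely many members essentially. A
partition of unity splits `h` among these, and the remainder vanishes on the compact set. -/
theorem IsFinitelyConcentrated.sUnion {φ : C(K, ℝ) →L[ℝ] ℝ} {𝒱 : Set (Set K)}
    (hopen : ∀ V ∈ 𝒱, IsOpen V) (h𝒱 : ∀ V ∈ 𝒱, IsFinitelyConcentrated φ V) :
    IsFinitelyConcentrated φ (⋃₀ 𝒱) := by
  classical
  intro ε hε
  obtain ⟨C, hCU, hC, hφC⟩ := exists_isCompact_abs_apply_le φ (⋃₀ 𝒱) (half_pos hε)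
  rw [sUnion_eq_iUnion] at hCU
  obtain ⟨t, ht⟩ := hC.elim_finite_subcover (fun V : 𝒱 ↦ (V : Set K))
    (fun V ↦ hopen V V.2) hCU
  obtain ⟨p, hp⟩ := PartitionOfUnity.exists_isSubordinate hC.isClosed
    (fun V : t ↦ (V.1 : Set K)) (fun V ↦ hopen V.1 V.1.2)
    (by simpa only [iUnion_coe_set, iUnion_subtype] using ht)
  have hη : 0 < ε / 2 / (t.card + 1) := by positivity
  choose S hS using fun V : t ↦ h𝒱 V.1 V.1.2 (ε / 2 / (t.card + 1)) hη
  refine ⟨Finset.univ.biUnion S, fun h hh hhU hhS ↦ ?_⟩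
  have hsum (x : K) : ∑ᶠ V, p V x = ∑ V, p V x := finsum_eq_sum_of_fintype _
  have hdec : h = ∑ V, h * p V + h * (1 - ∑ V, p V) := by
    rw [← Finset.mul_sum]; ring
  have hrest : |φ (h * (1 - ∑ V, p V))| ≤ ε / 2 := by
    refine hφC _ ((ContinuousMap.norm_le _ zero_le_one).2 fun x ↦ ?_) (fun x hx ↦ ?_)
      (fun x hx ↦ ?_)
    · have h₀ : 0 ≤ ∑ V, p V x := Finset.sum_nonneg fun V _ ↦ p.nonneg V x
      have h₁ : ∑ V, p V x ≤ 1 := hsum x ▸ p.sum_le_one x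
      simp only [ContinuousMap.mul_apply, ContinuousMap.sub_apply, ContinuousMap.one_apply,
        ContinuousMap.sum_apply, norm_mul]
      refine mul_le_one₀ ((h.norm_coe_le_norm x).trans hh) (norm_nonneg _) ?_
      rw [Real.norm_eq_abs, abs_le]
      constructor <;> linarith
    · simp [hhU x hx]
    · have h₁ : ∑ V, p V x = 1 := hsum x ▸ p.sum_eq_one hx
      rw [ContinuousMap.mul_apply, ContinuousMap.sub_apply, ContinuousMap.sum_apply, h₁,
        ContinuousMap.one_apply, sub_self, mul_zero]
  have hpart (V : t) : |φ (h * p V)| ≤ ε / 2 / (t.card + 1) := by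
    refine hS V _ ((ContinuousMap.norm_le _ zero_le_one).2 fun x ↦ ?_) (fun x hx ↦ ?_)
      (fun x hx ↦ ?_)
    · rw [ContinuousMap.mul_apply, norm_mul]
      refine mul_le_one₀ ((h.norm_coe_le_norm x).trans hh) (norm_nonneg _) ?_
      rw [Real.norm_eq_abs, abs_of_nonneg (p.nonneg V x)]
      exact p.le_one V x
    · have : p V x = 0 := by
        by_contra hne
        exact hx (hp V (subset_tsupport _ hne))
      simp [this]
    · simp [hhS x (Finset.mem_biUnion.2 ⟨V, Finset.mem_univ _, hx⟩)]
  have hparts : |∑ V, φ (h * p V)| ≤ ε / 2 := by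
    refine (Finset.abs_sum_le_sum_abs _ _).trans
      ((Finset.sum_le_card_nsmul _ _ _ fun V _ ↦ hpart V).trans ?_)
    rw [Finset.card_univ, Fintype.card_coe, nsmul_eq_mul]
    have hcard : (0 : ℝ) < t.card + 1 := Nat.cast_add_one_pos _
    have := mul_div_cancel₀ (ε / 2) hcard.ne'
    linarith
  rw [hdec, map_add, map_sum]
  exact (abs_add_le _ _).trans (by linarith)

/-- The largest open set of concentration is everything: an isolated point of its complement would
have a neighbourhood whose other points lie in it, and adding that one point to the finite set
absorbs the neighbourhood. -/
theorem IsScattered.isFinitelyConcentrated_univ (hK : IsScattered K) (φ : C(K, ℝ) →L[ℝ] ℝ) :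
    IsFinitelyConcentrated φ univ := by
  classical
  set 𝒱 : Set (Set K) := {V | IsOpen V ∧ IsFinitelyConcentrated φ V} with h𝒱
  have hG : IsFinitelyConcentrated φ (⋃₀ 𝒱) :=
    IsFinitelyConcentrated.sUnion (fun V hV ↦ hV.1) fun V hV ↦ hV.2
  suffices ⋃₀ 𝒱 = univ by rwa [this] at hG
  by_contra hne
  obtain ⟨x, hx, W, hW, hWx⟩ := hK (⋃₀ 𝒱)ᶜ (nonempty_compl.2 hne)
  have hWG : ∀ y ∈ W, y ≠ x → y ∈ ⋃₀ 𝒱 := by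
    intro y hy hyx
    by_contra hyG
    have hmem : y ∈ W ∩ (⋃₀ 𝒱)ᶜ := ⟨hy, hyG⟩
    rw [hWx] at hmem
    exact hyx hmem
  have hxW : x ∈ W := (hWx ▸ mem_singleton x : x ∈ W ∩ (⋃₀ 𝒱)ᶜ).1
  refine hx (mem_sUnion.2 ⟨W, ⟨hW, fun ε hε ↦ ?_⟩, hxW⟩)
  obtain ⟨S, hS⟩ := hG ε hε
  refine ⟨insert x S, fun h hh hhW hhS ↦ hS h hh (fun y hy ↦ ?_)
    fun y hy ↦ hhS y (Finset.mem_insert_of_mem hy)⟩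
  by_cases hyx : y = x
  · exact hyx ▸ hhS x (Finset.mem_insert_self _ _)
  · exact hhW y fun hyW ↦ hy (hWG y hyW hyx)

/-- On a scattered compact space, bounded functions that are small on a suitable finite set have
small image under a given functional. -/
theorem IsScattered.exists_finset_abs_apply_lt (hK : IsScattered K) (φ : C(K, ℝ) →L[ℝ] ℝ)
    {M ε : ℝ} (hM : 0 < M) (hε : 0 < ε) :
    ∃ S : Finset K, ∃ δ > 0, ∀ h : C(K, ℝ), ‖h‖ ≤ M → (∀ x ∈ S, |h x| < δ) → |φ h| < ε := by
  obtain ⟨S, hS⟩ := hK.isFinitelyConcentrated_univ φ (ε / 4 / M) (by positivity)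
  obtain ⟨δ, hδ, hδε⟩ : ∃ δ > 0, ‖φ‖ * δ ≤ ε / 2 := by
    refine ⟨ε / 2 / (‖φ‖ + 1), by positivity, ?_⟩
    rw [mul_div_assoc', div_le_iff₀ (by positivity)]
    nlinarith [norm_nonneg φ]
  refine ⟨S, δ, hδ, fun h hh hhS ↦ ?_⟩
  have h₁ : |φ (h - softThreshold δ h)| ≤ ε / 2 :=
    (φ.le_of_opNorm_le_of_le le_rfl (norm_sub_softThreshold_le hδ.le h)).trans hδε
  have h₂ : |φ (M⁻¹ • softThreshold δ h)| ≤ ε / 4 / M := by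
    refine hS _ ?_ (fun x hx ↦ absurd (mem_univ x) hx) fun x hx ↦ ?_
    · rw [norm_smul, norm_inv, Real.norm_eq_abs, abs_of_pos hM, inv_mul_le_iff₀ hM, mul_one]
      exact (norm_softThreshold_le hδ.le h).trans hh
    · simp [softThreshold_eq_zero (hhS x hx).le]
  rw [map_smul, smul_eq_mul, abs_mul, abs_inv, abs_of_pos hM, inv_mul_le_iff₀ hM,
    mul_div_cancel₀ _ hM.ne'] at h₂
  calc |φ h| = |φ (h - softThreshold δ h) + φ (softThreshold δ h)| := by
        rw [← map_add, sub_add_cancel]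
    _ ≤ _ := abs_add_le _ _
    _ < ε := by linarith

/-- On norm-bounded sets over a scattered compact space, weakly open sets are neighbourhoods for
pointwise convergence. -/
theorem IsScattered.exists_finset_forall_mem_of_isOpen (hK : IsScattered K)
    {U : Set (WeakSpace ℝ C(K, ℝ))} (hU : IsOpen U) {f : C(K, ℝ)} (hf : toWeakSpace ℝ _ f ∈ U)
    (M : ℝ) :
    ∃ S : Finset K, ∃ δ > 0, ∀ g : C(K, ℝ), ‖g‖ ≤ M → (∀ x ∈ S, |g x - f x| < δ) →
      toWeakSpace ℝ _ g ∈ U := by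
  classical
  set L : Filter C(K, ℝ) := (⨅ q : Finset K × {δ : ℝ // 0 < δ},
    𝓟 {g : C(K, ℝ) | ‖g‖ ≤ M ∧ ∀ x ∈ q.1, |g x - f x| < q.2}) with hL
  have : Nonempty {δ : ℝ // 0 < δ} := ⟨⟨1, one_pos⟩⟩
  have hbasis : L.HasBasis (fun _ ↦ True) fun q : Finset K × {δ : ℝ // 0 < δ} ↦
      {g : C(K, ℝ) | ‖g‖ ≤ M ∧ ∀ x ∈ q.1, |g x - f x| < q.2} := by
    refine hasBasis_iInf_principal ?_
    rintro ⟨S, δ, hδ⟩ ⟨T, η, hη⟩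
    refine ⟨⟨S ∪ T, min δ η, lt_min hδ hη⟩, fun g hg ↦ ⟨hg.1, fun x hx ↦ ?_⟩,
      fun g hg ↦ ⟨hg.1, fun x hx ↦ ?_⟩⟩
    · exact (hg.2 x (Finset.mem_union_left _ hx)).trans_le (min_le_left _ _)
    · exact (hg.2 x (Finset.mem_union_right _ hx)).trans_le (min_le_right _ _)
  have htend : Tendsto (toWeakSpace ℝ C(K, ℝ)) L (𝓝 (toWeakSpace ℝ _ f)) := by
    refine (WeakBilin.tendsto_iff_forall_eval_tendsto (topDualPairing ℝ C(K, ℝ)).flip ?_).2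
      fun φ ↦ ?_
    · intro a b hab
      by_contra hne
      obtain ⟨φ, hφ⟩ := SeparatingDual.exists_separating_of_ne (R := ℝ) hne
      exact hφ (LinearMap.congr_fun hab φ)
    · refine (hbasis.tendsto_iff Metric.nhds_basis_ball).2 fun ε hε ↦ ?_
      -- This radius bounds `‖g - f‖` and is positive even if `M` is not.
      obtain ⟨S, δ, hδ, h⟩ := hK.exists_finset_abs_apply_lt φ
        (M := |M| + ‖f‖ + 1) (by positivity) hε
      refine ⟨⟨S, δ, hδ⟩, trivial, fun g hg ↦ ?_⟩
      have := h (g - f) ((norm_sub_le _ _).trans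
        (by linarith [hg.1, le_abs_self M])) fun x hx ↦ by simpa using hg.2 x hx
      rw [map_sub] at this
      exact this
  obtain ⟨⟨S, δ, hδ⟩, -, h⟩ := hbasis.mem_iff.1 (htend (hU.mem_nhds hf))
  exact ⟨S, δ, hδ, fun g hg hgS ↦ h ⟨hg, hgS⟩⟩

end FunctionalsOnScatteredSpaces

/-! ### Diverse points, interpolation, and necessity of diversity -/

section Diversity

theorem IsDiversePoint.mem_of_apply_eq {K : Type*} {m k : ℕ} {F : Fin k → Set (Fin m)} {x : Fin m → K}
    (hx : IsDiversePoint F x) {i : Fin k} {j l : Fin m} (hj : j ∈ F i) (h : x j = x l) :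
    l ∈ F i := by
  by_contra hl
  exact (Set.mem_empty_iff_false (x j)).1 (hx i ▸ ⟨mem_image_of_mem x hj, l, hl, h.symm⟩)

/-- The partition into fibres of `z`, and diversity with respect to it. -/
theorem exists_isPartitionInto_fibres {K : Type*} {m : ℕ} {ι : Type*} (z : Fin m → ι) :
    ∃ (k : ℕ) (F : Fin k → Set (Fin m)), IsPartitionInto F ∧
      ∀ x : Fin m → K, IsDiversePoint F x ↔ ∀ j l, x j = x l → z j = z l := by
  classical
  obtain ⟨k, ⟨e⟩⟩ : ∃ k, Nonempty (range z ≃ Fin k) :=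
    ⟨_, ⟨Finite.equivFin (range z)⟩⟩
  have he (j : Fin m) (i : Fin k) : z j = (e.symm i : ι) ↔ e ⟨z j, mem_range_self j⟩ = i := by
    rw [← e.eq_symm_apply, Subtype.ext_iff]
  refine ⟨k, fun i ↦ {j | z j = e.symm i}, ⟨fun i ↦ ?_, fun i i' hii' ↦ ?_, ?_⟩, fun x ↦ ?_⟩
  · obtain ⟨j, hj⟩ := (e.symm i).2
    exact ⟨j, hj⟩
  · refine disjoint_left.2 fun j hj hj' ↦ hii' ?_
    exact e.symm.injective (Subtype.ext (hj.symm.trans hj'))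
  · exact eq_univ_of_forall fun j ↦ mem_iUnion.2 ⟨e ⟨z j, mem_range_self j⟩, (he j _).2 rfl⟩
  · refine ⟨fun hx j l hjl ↦ ?_, fun hx i ↦ ?_⟩
    · have hj := (he j (e ⟨z j, mem_range_self j⟩)).2 rfl
      exact hj.trans (hx.mem_of_apply_eq (i := e ⟨z j, mem_range_self j⟩) hj hjl).symm
    · rw [eq_empty_iff_forall_notMem]
      rintro _ ⟨⟨j, hj, rfl⟩, l, hl, hlj⟩
      exact hl ((hx l j hlj).trans hj)

theorem IsPartitionInto.exists_index {m k : ℕ} {F : Fin k → Set (Fin m)}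
    (hF : IsPartitionInto F) : ∃ c : Fin m → Fin k, ∀ i j, j ∈ F i ↔ c j = i := by
  have h (j : Fin m) : ∃ i, j ∈ F i := mem_iUnion.1 (hF.cover ▸ mem_univ j)
  choose c hc using h
  refine ⟨c, fun i j ↦ ⟨fun hj ↦ ?_, fun hj ↦ hj ▸ hc j⟩⟩
  by_contra hne
  exact disjoint_left.1 (hF.disjoint _ _ hne) (hc j) hj

/-- Tietze extension from the closed discrete set `range x`, keeping the bounds. -/
theorem exists_continuousMap_apply_eq {K : Type*} [TopologicalSpace K] [CompactSpace K] [T2Space K] {ι : Type*} [Finite ι]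
    (x : ι → K) (v : ι → ℝ) (hxv : ∀ j l, x j = x l → v j = v l) {M : ℝ} (hM : 0 ≤ M)
    (hv : ∀ j, |v j| ≤ M) :
    ∃ g : C(K, ℝ), ‖g‖ ≤ M ∧ ∀ j, g (x j) = v j := by
  classical
  have : DiscreteTopology (range x) := (finite_range x).isDiscrete.to_subtype
  choose s hs using fun y : range x ↦ y.2
  let f : C(range x, ℝ) := ⟨fun y ↦ v (s y), continuous_of_discreteTopology⟩
  obtain ⟨g, hg, hgf⟩ := BoundedContinuousFunction.exists_extension_forall_mem_Icc_of_isClosedEmbedding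
    (BoundedContinuousFunction.mkOfCompact f) (a := -M) (b := M) (e := ((↑) : range x → K))
    (fun y ↦ abs_le.1 (hv _)) (by linarith) (finite_range x).isClosed.isClosedEmbedding_subtypeVal
  refine ⟨g.toContinuousMap, (ContinuousMap.norm_le _ hM).2 fun y ↦ abs_le.2 (hg y), fun j ↦ ?_⟩
  exact (congr_fun hgf ⟨x j, mem_range_self j⟩).trans (hxv _ _ (hs ⟨x j, mem_range_self j⟩))

theorem mk_Iio_omega_one : Cardinal.mk (Iio (ω₁ : Ordinal.{0})) = Cardinal.aleph 1 := by
  rw [Cardinal.mk_Iio_ordinal, Ordinal.card_omega, Cardinal.lift_aleph]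
  simp

theorem uncountable_Iio_omega_one : Uncountable (Iio (ω₁ : Ordinal.{0})) := by
  rw [← Cardinal.aleph0_lt_mk_iff, mk_Iio_omega_one]
  exact Cardinal.aleph0_lt_aleph_one

universe u in
theorem exists_injective_of_uncountable (α : Type u) [Uncountable α] :
    ∃ e : Iio (ω₁ : Ordinal.{0}) → α, Function.Injective e := by
  have : Cardinal.lift.{u} (Cardinal.mk (Iio (ω₁ : Ordinal.{0}))) ≤
      Cardinal.lift.{1} (Cardinal.mk α) := by
    rw [mk_Iio_omega_one, Cardinal.lift_aleph]
    simp
  obtain ⟨e⟩ := Cardinal.lift_mk_le'.1 this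
  exact ⟨e, e.injective⟩

/-- An uncountable set, mapped to a countable type, has an uncountable fibre. -/
theorem exists_uncountable_fibre {α β : Type*} [Countable β] {s : Set α} (hs : ¬ s.Countable)
    (d : α → β) : ∃ b, ¬ {a ∈ s | d a = b}.Countable := by
  by_contra! h
  have hU : (⋃ b, {a ∈ s | d a = b}).Countable := countable_iUnion h
  refine hs (hU.mono fun a ha ↦ ?_)
  rw [mem_iUnion]
  exact ⟨d a, ha, rfl⟩

theorem IsWeaklyPcc.isNDiverse {K : Type*} [TopologicalSpace K] [CompactSpace K] [T2Space K] (hpcc : IsWeaklyPcc C(K, ℝ)) (n : ℕ) :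
    IsNDiverse K n := by
  intro m k F _ hF u hu
  by_contra! hno
  obtain ⟨c, hc⟩ := hF.exists_index
  -- Labels are distinct integers, so radius 1/3 keeps them apart even after passing to closed
  -- conditions in the limit.
  let V (α : Iio (ω₁ : Ordinal.{0})) : Set (WeakSpace ℝ C(K, ℝ)) :=
    {f | ∀ j, |(toWeakSpace ℝ _).symm f (u α j) - (c j : ℕ)| < 1 / 3}
  have hVopen (α) : IsOpen (V α) := by
    simp only [V, ofPred_forall]
    refine isOpen_iInter_of_finite fun j ↦ ?_
    have : Continuous fun f : WeakSpace ℝ C(K, ℝ) ↦ (toWeakSpace ℝ _).symm f (u α j) :=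
      WeakBilin.eval_continuous (topDualPairing ℝ C(K, ℝ)).flip
        (ContinuousMap.evalCLM ℝ (u α j) : C(K, ℝ) →L[ℝ] ℝ)
    exact isOpen_lt (by fun_prop) continuous_const
  have hVne (α) : (V α).Nonempty := by
    obtain ⟨g, -, hg⟩ := exists_continuousMap_apply_eq (u α) (fun j ↦ ((c j : ℕ) : ℝ))
      (fun j l hjl ↦ by
        have := (hu α).mem_of_apply_eq ((hc _ j).2 rfl) hjl
        rw [hc] at this
        rw [this]) (M := k) (by positivity)
      (fun j ↦ by
        rw [abs_of_nonneg (by positivity)]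
        exact_mod_cast (c j).2.le)
    refine ⟨toWeakSpace ℝ _ g, fun j ↦ ?_⟩
    rw [LinearEquiv.symm_apply_apply, hg, sub_self, abs_zero]
    norm_num
  have hVfin (f : WeakSpace ℝ C(K, ℝ)) : {α | f ∈ V α}.Finite := by
    by_contra hinf
    set g : C(K, ℝ) := (toWeakSpace ℝ _).symm f
    set C : Set (Fin m → K) := {y | ∀ j, |g (y j) - (c j : ℕ)| ≤ 1 / 3} with hC
    have hCclosed : IsClosed C := by
      simp only [hC, ofPred_forall]
      exact isClosed_iInter fun j ↦ isClosed_le (by fun_prop) continuous_const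
    have hfreq : ∃ᶠ α in cofinite, u α ∈ C := by
      refine (frequently_cofinite_iff_infinite.2 hinf).mono fun α hα j ↦ (hα j).le
    obtain ⟨x, hxC, hx⟩ := hCclosed.isCompact.exists_mapClusterPt_of_frequently hfreq
    refine hno x (fun i ↦ ?_) hx
    rw [eq_empty_iff_forall_notMem]
    rintro _ ⟨⟨j, hj, rfl⟩, l, hl, hlj⟩
    rw [hc] at hj
    rw [mem_compl_iff, hc] at hl
    have h₁ := abs_le.1 (hxC j)
    have h₂ := abs_le.1 (hxC l)
    rw [hlj] at h₂
    have h₃ : ((c j : ℕ) : ℝ) < (c l : ℕ) + 1 := by linarith [h₁.1, h₂.2]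
    have h₄ : ((c l : ℕ) : ℝ) < (c j : ℕ) + 1 := by linarith [h₁.2, h₂.1]
    norm_cast at h₃ h₄
    exact hl ((Fin.ext (by omega)).trans hj)
  have hcount := hpcc (range V) (by rintro _ ⟨α, rfl⟩; exact hVopen α) fun f ↦
    ((hVfin f).image V).subset (by rintro _ ⟨⟨α, rfl⟩, hα⟩; exact ⟨α, hα, rfl⟩)
  have := uncountable_Iio_omega_one
  refine not_countable_univ (α := Iio (ω₁ : Ordinal.{0})) ?_
  -- The sets `V α` may repeat, but a fibre is finite: one function in `V α` belongs to every set
  -- equal to it.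
  have hfib : (⋃ W ∈ range V, {α | V α = W}).Countable := hcount.biUnion ?_
  · exact hfib.mono fun α _ ↦ mem_biUnion (mem_range_self α) (rfl : V α = V α)
  rintro _ ⟨α, rfl⟩
  obtain ⟨f, hf⟩ := hVne α
  exact ((hVfin f).subset fun β (hβ : V β = V α) ↦ by rwa [mem_ofPred_eq, hβ]).countable

end Diversity

/-! ### Sufficiency of diversity -/

/-- Each nonempty weakly open set contains a set prescribed, up to an error, by a norm bound and
the values at finitely many points, where the data beside the points are integers. -/
theorem IsScattered.exists_weak_box {K : Type*} [TopologicalSpace K] [CompactSpace K] [T2Space K]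
    (hK : IsScattered K) {U : Set (WeakSpace ℝ C(K, ℝ))} (hU : IsOpen U) (hne : U.Nonempty) :
    ∃ (d : Σ m : ℕ, ℕ × ℕ × (Fin m → ℤ)) (x : Fin d.1 → K),
      0 < d.2.2.1 ∧ (∀ j l, x j = x l → d.2.2.2 j = d.2.2.2 l) ∧
      (∀ j, |(d.2.2.2 j : ℝ) / d.2.2.1| ≤ d.2.1) ∧
      ∀ g : C(K, ℝ), ‖g‖ ≤ d.2.1 →
        (∀ j, |g (x j) - (d.2.2.2 j : ℝ) / d.2.2.1| < 1 / d.2.2.1) → toWeakSpace ℝ _ g ∈ U := by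
  obtain ⟨f, hf⟩ := hne
  set f' : C(K, ℝ) := (toWeakSpace ℝ _).symm f
  -- The extra 1 leaves room for the rounded values.
  obtain ⟨M, hM⟩ := exists_nat_ge (‖f'‖ + 1)
  obtain ⟨S, δ, hδ, hS⟩ := hK.exists_finset_forall_mem_of_isOpen hU (f := f') hf M
  -- Rounding error and box tolerance each cost `1 / N`.
  obtain ⟨N, hN⟩ := exists_nat_gt (2 / δ)
  have hN₀ : (0 : ℝ) < N := (by positivity : 0 < 2 / δ).trans hN
  have hN₁ : (1 : ℝ) ≤ N := by exact_mod_cast hN₀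
  have hNδ : 1 / (N : ℝ) + 1 / N < δ := by
    rw [← add_div, div_lt_iff₀ hN₀]
    rw [div_lt_iff₀ hδ] at hN
    linarith
  have hround (y : K) : |(⌊f' y * N⌋ : ℝ) / N - f' y| ≤ 1 / N := by
    have h₁ := Int.floor_le (f' y * N)
    have h₂ := Int.lt_floor_add_one (f' y * N)
    have : (⌊f' y * N⌋ : ℝ) / N - f' y = (⌊f' y * N⌋ - f' y * N) / N := by field_simp
    rw [this, abs_div, abs_of_pos hN₀]
    gcongr
    rw [abs_le]
    constructor <;> linarith
  let x : Fin S.card → K := fun j ↦ S.equivFin.symm j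
  refine ⟨⟨S.card, M, N, fun j ↦ ⌊f' (x j) * N⌋⟩, x, by exact_mod_cast hN₀,
    fun j l hjl ↦ ?_, fun j ↦ ?_, fun g hg hgx ↦ hS g hg fun y hy ↦ ?_⟩
  · simp only [hjl]
  · have h₁ := hround (x j)
    have h₂ : |f' (x j)| ≤ ‖f'‖ := f'.norm_coe_le_norm (x j)
    have h₃ : 1 / (N : ℝ) ≤ 1 := (div_le_one hN₀).2 hN₁
    have h₄ := abs_add_le ((⌊f' (x j) * N⌋ : ℝ) / N - f' (x j)) (f' (x j))
    rw [sub_add_cancel] at h₄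
    change |(⌊f' (x j) * N⌋ : ℝ) / N| ≤ M
    linarith
  · have h₁ := hgx (S.equivFin ⟨y, hy⟩)
    simp only [x, Equiv.symm_apply_apply] at h₁
    exact ((abs_sub_le _ _ _).trans_lt (add_lt_add_of_lt_of_le h₁ (hround y))).trans hNδ

theorem IsScattered.isWeaklyPcc {K : Type*} [TopologicalSpace K] [CompactSpace K] [T2Space K]
    (hK : IsScattered K) (hdiv : ∀ n, IsNDiverse K n) : IsWeaklyPcc C(K, ℝ) := by
  classical
  intro 𝒰 hopen hfin
  by_contra hunc
  have hunc' : ¬ {U ∈ 𝒰 | U.Nonempty}.Countable := fun h ↦ hunc <| (h.insert ∅).mono fun U hU ↦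
    U.eq_empty_or_nonempty.imp id fun hne ↦ ⟨hU, hne⟩
  choose! d hd using fun (U : Set (WeakSpace ℝ C(K, ℝ))) (hU : U ∈ {U ∈ 𝒰 | U.Nonempty}) ↦
    hK.exists_weak_box (hopen U hU.1) hU.2
  obtain ⟨⟨m, M, N, z⟩, hfib⟩ := exists_uncountable_fibre hunc' d
  have : Uncountable {U ∈ {U ∈ 𝒰 | U.Nonempty} | d U = ⟨m, M, N, z⟩} := by
    rwa [← not_countable_iff, countable_coe_iff]
  obtain ⟨e, he⟩ := exists_injective_of_uncountable
    {U ∈ {U ∈ 𝒰 | U.Nonempty} | d U = ⟨m, M, N, z⟩}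
  have hbox (α) : ∃ x : Fin m → K, 0 < N ∧ (∀ j l, x j = x l → z j = z l) ∧
      (∀ j, |(z j : ℝ) / N| ≤ M) ∧ ∀ g : C(K, ℝ), ‖g‖ ≤ M →
        (∀ j, |g (x j) - (z j : ℝ) / N| < 1 / N) → toWeakSpace ℝ _ g ∈ (e α).1 := by
    have h := hd (e α).1 (e α).2.1
    rwa [(e α).2.2] at h
  choose u hN hu hzM hmem using hbox
  have : Nonempty (Iio (ω₁ : Ordinal.{0})) := by
    have := uncountable_Iio_omega_one
    infer_instance
  obtain ⟨α₀⟩ := this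
  have hN' : (0 : ℝ) < N := by exact_mod_cast hN α₀
  obtain ⟨k, F, hF, hFx⟩ := exists_isPartitionInto_fibres (K := K) z
  -- The number `k` of pieces depends on the family, hence diversity for every `n`.
  obtain ⟨x, hx, hxu⟩ := hdiv k m k F le_rfl hF u fun α ↦ (hFx _).2 (hu α)
  obtain ⟨g, hgM, hg⟩ := exists_continuousMap_apply_eq x (fun j ↦ (z j : ℝ) / N)
    (fun j l hjl ↦ by rw [(hFx x).1 hx j l hjl]) (Nat.cast_nonneg M) (hzM α₀)
  have hnhds : {y : Fin m → K | ∀ j, |g (y j) - (z j : ℝ) / N| < 1 / N} ∈ 𝓝 x := by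
    refine IsOpen.mem_nhds ?_ fun j ↦ ?_
    · simp only [ofPred_forall]
      exact isOpen_iInter_of_finite fun j ↦ isOpen_lt (by fun_prop) continuous_const
    · rw [hg, sub_self, abs_zero]
      positivity
  have hinf := frequently_cofinite_iff_infinite.1 (hxu.frequently hnhds)
  -- Injectivity of `e` turns infinitely many indices into infinitely many members containing `g`.
  refine (hinf.image ((Subtype.val_injective.comp he).injOn)) ((hfin (toWeakSpace ℝ _ g)).subset ?_)
  rintro _ ⟨α, hα, rfl⟩
  exact ⟨(e α).2.1.1, hmem α g hgM hα⟩

theorem mainTheorem7 {K : Type*} [TopologicalSpace K] [CompactSpace K] [T2Space K]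
    (hK : IsScattered K) :
    IsWeaklyPcc C(K, ℝ) ↔ ∀ n : ℕ, IsNDiverse K n :=
  ⟨fun h n ↦ h.isNDiverse n, hK.isWeaklyPcc⟩
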